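/- **Setting.** Let $Y_1,Y_2,\dots$ be random elements. Under each parameter $\theta\in\Xi\subseteq\mathbb R^d$ they have a probability law $P_\theta$, with expectation $E_\theta$, under which $Y_i$ has density or mass function $p_i(\cdot\mid\theta)$ with respect to a $\sigma$-finite measure. Put $$\ell_{m:n}(\theta)=\sum_{i=m}^n\log p_i(Y_i\mid\theta),\qquad \ell=\ell_{1:n},\qquad h=-\ell/n .$$ Let $\pi\ge 0$ be a (possibly improper) prior density on $\Xi$. The posterior mean is $$E_{\rm post}[\Theta_k]=\frac{\int_\Xi\theta_k e^{\ell(\theta)}\pi(\theta)\,d\theta}{\int_\Xi e^{\ell(\theta)}\pi(\theta)\,d\theta}.$$ Let $\hat\theta=\hat\theta_n$ be a maximum likelihood estimator: a measurable function of $Y_1,\dots,Y_n$ which, $P_\theta$-almost surely for every $\theta\in\Xi$, lies in $\Xi$ and maximizes $\ell$ over $\Xi$ for all large $n$. Write $\partial_j=\partial/\partial\theta_j$ and $$\kappa_{rs}=\tfrac1nE_\theta\{\partial_r\partial_s\ell\},\quad \kappa_{r,s}=\tfrac1nE_\theta\{\partial_r\ell\,\partial_s\ell\},\quad \kappa_{rst}=\tfrac1nE_\theta\{\partial_r\partial_s\partial_t\ell\},$$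 $$\kappa_{r,st}=\tfrac1nE_\theta\{\partial_r\ell\,\partial_s\partial_t\ell\},\quad \kappa_{r,s,t}=\tfrac1nE_\theta\{\partial_r\ell\,\partial_s\ell\,\partial_t\ell\},$$ all evaluated at $\theta$ and depending on $n$. Let $\kappa^{r,s}$ be the entries of the inverse of the matrix $(\kappa_{r,s})$, and let $$B_{k,n}=\frac1{2n}\sum_{s,t,u}\kappa^{k,s}\kappa^{t,u}(\kappa_{stu}+2\kappa_{t,su}).$$ Hats denote evaluation at $\hat\theta$, subscripts on $h$ and $\pi$ denote partial derivatives, and $(\hat h^{rs})$ is the inverse of the Hessian $(\hat h_{rs})$. Put $$L_k=\sum_j\hat h^{kj}\Big\{\frac{\hat\pi_j}{\hat\pi}-\frac12\sum_{r,s}\hat h^{rs}\hat h_{rsj}\Big\},$$ and define $R_{1n},R_{2n}$ (for each $k$) by $$E_{\rm post}[\Theta_k]=\hat\theta_k+\frac1nL_k+\frac{R_{1n}}{n^2},\qquad R_{2n}=L_k-\sum_j\kappa^{k,j}\Big\{\partial_j\log\pi(\theta_0)+\frac12\sum_{r,s}\kappa^{r,s}\kappa_{rsj}\Big\},$$ where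 the cumulants in $R_{2n}$ are taken at $\theta_0$. Let $\mathcal B_\epsilon(\theta_0)$ be the open ball of radius $\epsilon$ about $\theta_0$. **Conditions.** - [A1] $p_i(y\mid\theta)>0$ for all $i$, $y$ and $\theta\in\Xi$. On $\Xi$, $\ell$ is six times continuously differentiable for all data, and $\pi$ is four times continuously differentiable. - [A2] For all $\theta_0\in\Xi$ there are $\epsilon,M>0$ with $\mathcal B_\epsilon(\theta_0)\subseteq\Xi$ such that, for every partial derivative $\partial_{j_1\cdots j_q}$ with $0\le q\le 6$, $P_{\theta_0}$-almost surely $\limsup_n\sup_{\theta\in\mathcal B_\epsilon(\theta_0)}\frac1n|\partial_{j_1\cdots j_q}\ell(\theta)|<M$. - [A3] For all $\theta_0\in\Xi$ there is $\epsilon>0$ such that, $P_{\theta_0}$-almost surely, $\liminf_n\inf_{\theta\in\mathcal B_\epsilon(\theta_0)\cap\Xi}\det\big(-\frac1n\partial^2\ell(\theta)/\partial\theta\,\partial\theta^\top\big)>0$. - [A4] For all $\theta_0\in\Xi$ and $\delta>0$ there is $n_0\ge1$ such that, $P_{\theta_0}$-almost surely, $\limsup_n\sup_{\theta\in\Xi\setminus\mathcal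 B_\delta(\theta_0)}\frac1n\{\ell_{n_0:n}(\theta)-\ell_{n_0:n}(\theta_0)\}<0$, and both $\int_\Xi\|\theta\|e^{\ell_{1:n_0-1}(\theta)}\pi(\theta)\,d\theta$ and $\int_\Xi e^{\ell_{1:n_0-1}(\theta)}\pi(\theta)\,d\theta$ are finite (where $\ell_{1:0}=0$). - [A5] The $Y_i$ are independent under every $P_\theta$, $\theta\in\Xi$. For every $\theta\in\Xi$ the cumulants above exist and are finite, $(\kappa_{r,s})$ is invertible for all large $n$, and the Bartlett identities hold: $E_\theta\{\partial_r\ell\}=0$, $\kappa_{rs}+\kappa_{r,s}=0$ and $\kappa_{rst}+\kappa_{r,st}+\kappa_{s,rt}+\kappa_{t,rs}+\kappa_{r,s,t}=0$. - [A6] For all large $n$ the two integrals defining the posterior mean converge absolutely $P_{\theta_0}$-almost surely; for every $k$, $R_{1n}$ is $P_{\theta_0}$-integrable for all large $n$ and $E_{\theta_0}\{R_{1n}\}=O(1)$. - [A7] For every $k$, $R_{2n}$ is $P_{\theta_0}$-integrable for all large $n$ and $E_{\theta_0}\{R_{2n}\}=o(1)$. - [A8] For every $k$, $\hat\theta_k$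 is $P_{\theta_0}$-integrable for all large $n$ and $E_{\theta_0}\{\hat\theta_k-\theta_{0k}\}=B_{k,n}+R_{3n}/n$ with $R_{3n}\to0$, where $B_{k,n}$ is taken at $\theta_0$. **Proposition.** Assume [A1]–[A5], let $\theta_0\in\Xi$ be the true parameter, let $\pi(\theta_0)>0$, and assume [A6]–[A8] at $\theta_0$. Then for each $k=1,\dots,d$ the posterior mean $E_{\rm post}[\Theta_k]$ is $P_{\theta_0}$-integrable for all large $n$, and, as $n\to\infty$, $$E_{\theta_0}\{E_{\rm post}[\Theta_k]-\theta_{0k}\}=\frac1n\sum_j\kappa^{k,j}\Big\{\partial_j\log\pi(\theta_0)+\sum_{r,s}\kappa^{r,s}(\kappa_{rsj}+\kappa_{r,js})\Big\}+o\Big(\frac1n\Big),$$ where the cumulants are taken at $\theta_0$. -/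

import Mathlib

open MeasureTheory ProbabilityTheory Filter Topology Asymptotics

namespace PosteriorBias

noncomputable section

/-- The ambient space of the parameter `θ = (θ₁, …, θ_d)`, with its Euclidean norm. -/
abbrev Par (d : ℕ) : Type := EuclideanSpace ℝ (Fin d)

/-- The partial derivative `∂f/∂θ_j`, as a function of `θ`. -/
def pd {d : ℕ} (j : Fin d) (f : Par d → ℝ) : Par d → ℝ :=
  fun θ => fderiv ℝ f θ (EuclideanSpace.single j 1)

/-- The iterated partial derivative `∂_{j₁ ⋯ j_q} f`, for the list `J = [j₁, …, j_q]`. -/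
def pdList {d : ℕ} (J : List (Fin d)) (f : Par d → ℝ) : Par d → ℝ :=
  J.foldr pd f

/-- A parametric model with a prior.  The observations `Y 0, Y 1, …` are random elements on
`Ω`; under the parameter `θ ∈ Ξ` the law of `Y i` has the density (or mass function)
`dens i θ` with respect to the σ-finite measure `base i`.  The prior density need not be
normalized, nor have a finite integral. -/
structure Model (d : ℕ) (Ω : Type*) [MeasurableSpace Ω]
    (𝒴 : ℕ → Type*) [∀ i, MeasurableSpace (𝒴 i)] where
  /-- the parameter space -/
  Ξ : Set (Par d)
  /-- the dominating measures (Lebesgue or counting measure, for instance) -/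
  base : ∀ i, Measure (𝒴 i)
  /-- `dens i θ y` is `p_i(y | θ)` -/
  dens : ∀ i, Par d → 𝒴 i → ℝ
  /-- the prior density `π` -/
  prior : Par d → ℝ
  /-- the observations -/
  Y : ∀ i, Ω → 𝒴 i
  /-- `P θ` is the probability measure under the parameter `θ` -/
  P : Par d → Measure Ω
  base_sigmaFinite : ∀ i, SigmaFinite (base i)
  dens_measurable : ∀ i, ∀ θ ∈ Ξ, Measurable (dens i θ)
  prior_nonneg : ∀ θ ∈ Ξ, 0 ≤ prior θ
  Y_measurable : ∀ i, Measurable (Y i)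
  P_isProbabilityMeasure : ∀ θ ∈ Ξ, IsProbabilityMeasure (P θ)
  law_Y : ∀ i, ∀ θ ∈ Ξ,
    (P θ).map (Y i) = (base i).withDensity (fun y => ENNReal.ofReal (dens i θ y))

/-- An estimator: for each sample size `n` a function of the first `n` observations. -/
abbrev Estimator (d : ℕ) (𝒴 : ℕ → Type*) : Type _ :=
  ∀ n : ℕ, (∀ i : Fin n, 𝒴 i) → Par d

variable {d : ℕ} {Ω : Type*} [MeasurableSpace Ω] {𝒴 : ℕ → Type*} [∀ i, MeasurableSpace (𝒴 i)]

/-- The log-likelihood of the observations with (zero-based) index `m ≤ i < n`. -/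
def logLikPart (M : Model d Ω 𝒴) (m n : ℕ) (y : ∀ i, 𝒴 i) (θ : Par d) : ℝ :=
  ∑ i ∈ Finset.Ico m n, Real.log (M.dens i θ (y i))

/-- The log-likelihood `ℓ(θ)` of the first `n` observations. -/
def logLik (M : Model d Ω 𝒴) (n : ℕ) (y : ∀ i, 𝒴 i) (θ : Par d) : ℝ :=
  logLikPart M 0 n y θ

/-- The observed sequence. -/
def obs (M : Model d Ω 𝒴) (ω : Ω) : ∀ i, 𝒴 i := fun i => M.Y i ω

/-- The log-likelihood of the first `n` observations, at the observed data. -/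
def ell (M : Model d Ω 𝒴) (n : ℕ) (ω : Ω) : Par d → ℝ := logLik M n (obs M ω)

/-! ### Cumulants of log-likelihood derivatives -/

/-- `κ_{rs}` -/
def kap2 (M : Model d Ω 𝒴) (n : ℕ) (θ : Par d) (r s : Fin d) : ℝ :=
  (1 / (n : ℝ)) * ∫ ω, pdList [r, s] (ell M n ω) θ ∂(M.P θ)

/-- `κ_{r,s}` -/
def kap11 (M : Model d Ω 𝒴) (n : ℕ) (θ : Par d) (r s : Fin d) : ℝ :=
  (1 / (n : ℝ)) * ∫ ω, pd r (ell M n ω) θ * pd s (ell M n ω) θ ∂(M.P θ)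

/-- `κ_{r,s,t}` -/
def kap111 (M : Model d Ω 𝒴) (n : ℕ) (θ : Par d) (r s t : Fin d) : ℝ :=
  (1 / (n : ℝ)) *
    ∫ ω, pd r (ell M n ω) θ * pd s (ell M n ω) θ * pd t (ell M n ω) θ ∂(M.P θ)

/-- `κ_{rst}` -/
def kap3 (M : Model d Ω 𝒴) (n : ℕ) (θ : Par d) (r s t : Fin d) : ℝ :=
  (1 / (n : ℝ)) * ∫ ω, pdList [r, s, t] (ell M n ω) θ ∂(M.P θ)

/-- `κ_{r,st}` -/
def kap12 (M : Model d Ω 𝒴) (n : ℕ) (θ : Par d) (r s t : Fin d) : ℝ :=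
  (1 / (n : ℝ)) * ∫ ω, pd r (ell M n ω) θ * pdList [s, t] (ell M n ω) θ ∂(M.P θ)

/-- The matrix `(κ_{r,s})`. -/
def kapMatrix (M : Model d Ω 𝒴) (n : ℕ) (θ : Par d) : Matrix (Fin d) (Fin d) ℝ :=
  Matrix.of (kap11 M n θ)

/-- `κ^{r,s}`, the `(r,s)`-element of the inverse of the matrix `(κ_{r,s})`. -/
def kapInv (M : Model d Ω 𝒴) (n : ℕ) (θ : Par d) (r s : Fin d) : ℝ :=
  (kapMatrix M n θ)⁻¹ r s

/-- The first-order bias `B_{k,n}` of the maximum likelihood estimator. -/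
def mleBias (M : Model d Ω 𝒴) (n : ℕ) (θ : Par d) (k : Fin d) : ℝ :=
  (1 / (2 * (n : ℝ))) * ∑ s, ∑ t, ∑ u,
    kapInv M n θ k s * kapInv M n θ t u * (kap3 M n θ s t u + 2 * kap12 M n θ t s u)

/-! ### The maximum likelihood estimator and the posterior mean -/

/-- `θ̂` is a maximum likelihood estimator: it is measurable and, under every parameter, almost
surely maximizes the likelihood over `Ξ` as soon as `n` is large enough. -/
def IsMLE (M : Model d Ω 𝒴) (est : Estimator d 𝒴) : Prop :=
  (∀ n, Measurable (est n)) ∧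
  ∀ θ₀ ∈ M.Ξ, ∀ᵐ ω ∂(M.P θ₀), ∀ᶠ n : ℕ in atTop,
    est n (fun i => M.Y i ω) ∈ M.Ξ ∧
      ∀ θ ∈ M.Ξ, ell M n ω θ ≤ ell M n ω (est n (fun i => M.Y i ω))

/-- The value `θ̂` of the estimator at the observed data. -/
def hat (M : Model d Ω 𝒴) (est : Estimator d 𝒴) (n : ℕ) (ω : Ω) : Par d :=
  est n (fun i => M.Y i ω)

/-- The posterior has a finite normalizing integral and a finite first moment. -/
def PosteriorMeanExists (M : Model d Ω 𝒴) (n : ℕ) (ω : Ω) : Prop :=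
  IntegrableOn (fun θ => Real.exp (ell M n ω θ) * M.prior θ) M.Ξ volume ∧
  IntegrableOn (fun θ => ‖θ‖ * Real.exp (ell M n ω θ) * M.prior θ) M.Ξ volume

/-- The posterior mean `E_post[Θ_k]`. -/
def postMean (M : Model d Ω 𝒴) (n : ℕ) (k : Fin d) (ω : Ω) : ℝ :=
  (∫ θ in M.Ξ, θ k * Real.exp (ell M n ω θ) * M.prior θ) /
    (∫ θ in M.Ξ, Real.exp (ell M n ω θ) * M.prior θ)

/-- `h(θ) = -ℓ(θ)/n` -/
def hfun (M : Model d Ω 𝒴) (n : ℕ) (ω : Ω) (θ : Par d) : ℝ :=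
  -(1 / (n : ℝ)) * ell M n ω θ

/-- The Hessian matrix `(h_{rs}(θ))`. -/
def hessMatrix (M : Model d Ω 𝒴) (n : ℕ) (ω : Ω) (θ : Par d) : Matrix (Fin d) (Fin d) ℝ :=
  Matrix.of fun r s => pdList [r, s] (hfun M n ω) θ

/-- `ĥ^{rs}`, the `(r,s)`-element of the inverse of the Hessian of `h` at `θ̂`. -/
def hatInv (M : Model d Ω 𝒴) (est : Estimator d 𝒴) (n : ℕ) (ω : Ω) (r s : Fin d) : ℝ :=
  (hessMatrix M n ω (hat M est n ω))⁻¹ r s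

/-- The first-order term `∑_j ĥ^{kj} {π̂_j/π̂ - (1/2) ∑_{r,s} ĥ^{rs} ĥ_{rsj}}` of the Laplace
expansion of the posterior mean. -/
def laplaceTerm (M : Model d Ω 𝒴) (est : Estimator d 𝒴) (n : ℕ) (k : Fin d) (ω : Ω) : ℝ :=
  ∑ j, hatInv M est n ω k j *
    (pd j M.prior (hat M est n ω) / M.prior (hat M est n ω)
      - (1 / 2) * ∑ r, ∑ s,
          hatInv M est n ω r s * pdList [r, s, j] (hfun M n ω) (hat M est n ω))

/-- The remainder `R_{1n}`, defined by
`E_post[Θ_k] = θ̂_k + (1/n) ∑_j ĥ^{kj} {π̂_j/π̂ - (1/2) ∑_{r,s} ĥ^{rs} ĥ_{rsj}} + R_{1n}/n²`. -/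
def R1 (M : Model d Ω 𝒴) (est : Estimator d 𝒴) (n : ℕ) (k : Fin d) (ω : Ω) : ℝ :=
  (n : ℝ) ^ 2 *
    (postMean M n k ω - hat M est n ω k - (1 / (n : ℝ)) * laplaceTerm M est n k ω)

/-- The remainder `R_{2n}`: the difference between the first-order term of the Laplace expansion
at `θ̂` and its population version
`∑_j κ^{k,j} {∂_j log π(θ) + (1/2) ∑_{r,s} κ^{r,s} κ_{rsj}}` at `θ`. -/
def R2 (M : Model d Ω 𝒴) (est : Estimator d 𝒴) (θ : Par d) (n : ℕ) (k : Fin d) (ω : Ω) : ℝ :=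
  laplaceTerm M est n k ω
    - ∑ j, kapInv M n θ k j *
        (pd j (fun t => Real.log (M.prior t)) θ
          + (1 / 2) * ∑ r, ∑ s, kapInv M n θ r s * kap3 M n θ r s j)

/-! ### The conditions -/

/-- Positivity of the densities and smoothness of the log-likelihood and of the prior. -/
def A1 (M : Model d Ω 𝒴) : Prop :=
  (∀ i, ∀ θ ∈ M.Ξ, ∀ y : 𝒴 i, 0 < M.dens i θ y) ∧
  (∀ (n : ℕ) (y : ∀ i, 𝒴 i), ContDiffOn ℝ 6 (logLik M n y) M.Ξ) ∧
  ContDiffOn ℝ 4 M.prior M.Ξ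

/-- Local boundedness of the derivatives of the log-likelihood up to order six.  Suprema and
upper limits are taken in the extended reals. -/
def A2 (M : Model d Ω 𝒴) : Prop :=
  ∀ θ₀ ∈ M.Ξ, ∃ ε : ℝ, 0 < ε ∧ ∃ C : ℝ, 0 < C ∧ Metric.ball θ₀ ε ⊆ M.Ξ ∧
    ∀ J : List (Fin d), J.length ≤ 6 → ∀ᵐ ω ∂(M.P θ₀),
      limsup (fun n : ℕ => ⨆ θ ∈ Metric.ball θ₀ ε,
        (((1 / (n : ℝ)) * |pdList J (ell M n ω) θ| : ℝ) : EReal)) atTop < (C : EReal)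

/-- Local lower bound for the determinant of the observed information. -/
def A3 (M : Model d Ω 𝒴) : Prop :=
  ∀ θ₀ ∈ M.Ξ, ∃ ε : ℝ, 0 < ε ∧ ∀ᵐ ω ∂(M.P θ₀),
    (0 : EReal) < liminf (fun n : ℕ => ⨅ θ ∈ Metric.ball θ₀ ε ∩ M.Ξ,
      (((Matrix.of fun r s => -(1 / (n : ℝ)) * pdList [r, s] (ell M n ω) θ).det : ℝ) : EReal))
      atTop

/-- Separation of the true parameter, and finiteness of the posterior integrals based on an
initial stretch of observations (of length `m`, possibly zero). -/
def A4 (M : Model d Ω 𝒴) : Prop :=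
  ∀ θ₀ ∈ M.Ξ, ∀ δ : ℝ, 0 < δ → ∃ m : ℕ,
    (∀ᵐ ω ∂(M.P θ₀),
      limsup (fun n : ℕ => ⨆ θ ∈ M.Ξ \ Metric.ball θ₀ δ,
        (((1 / (n : ℝ)) * (logLikPart M m n (obs M ω) θ - logLikPart M m n (obs M ω) θ₀) : ℝ)
          : EReal)) atTop < 0) ∧
    (∀ᵐ ω ∂(M.P θ₀), PosteriorMeanExists M m ω)

/-- Independence; existence of the cumulants (and of the inverse matrix `(κ^{r,s})`, for large
`n`); the Bartlett identities up to order three. -/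
def A5 (M : Model d Ω 𝒴) : Prop :=
  (∀ θ ∈ M.Ξ, iIndepFun M.Y (M.P θ)) ∧
  (∀ θ ∈ M.Ξ, ∀ (n : ℕ) (r s t : Fin d),
    Integrable (fun ω => pdList [r, s] (ell M n ω) θ) (M.P θ) ∧
    Integrable (fun ω => pd r (ell M n ω) θ * pd s (ell M n ω) θ) (M.P θ) ∧
    Integrable (fun ω => pd r (ell M n ω) θ * pd s (ell M n ω) θ * pd t (ell M n ω) θ) (M.P θ) ∧
    Integrable (fun ω => pdList [r, s, t] (ell M n ω) θ) (M.P θ) ∧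
    Integrable (fun ω => pd r (ell M n ω) θ * pdList [s, t] (ell M n ω) θ) (M.P θ)) ∧
  (∀ θ ∈ M.Ξ, ∀ᶠ n : ℕ in atTop, IsUnit (kapMatrix M n θ).det) ∧
  (∀ θ ∈ M.Ξ, ∀ (n : ℕ) (r s t : Fin d),
    ∫ ω, pd r (ell M n ω) θ ∂(M.P θ) = 0 ∧
    kap2 M n θ r s + kap11 M n θ r s = 0 ∧
    kap3 M n θ r s t + kap12 M n θ r s t + kap12 M n θ s r t + kap12 M n θ t r s
      + kap111 M n θ r s t = 0)

/-- `R_{1n}` is well defined and integrable for large `n`, and `E_{θ₀}{R_{1n}} = O(1)`. -/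
def A6 (M : Model d Ω 𝒴) (est : Estimator d 𝒴) (θ₀ : Par d) : Prop :=
  (∀ᶠ n : ℕ in atTop, ∀ᵐ ω ∂(M.P θ₀), PosteriorMeanExists M n ω) ∧
  ∀ k : Fin d,
    (∀ᶠ n : ℕ in atTop, Integrable (R1 M est n k) (M.P θ₀)) ∧
    (fun n : ℕ => ∫ ω, R1 M est n k ω ∂(M.P θ₀)) =O[atTop] (fun _ => (1 : ℝ))

/-- `R_{2n}` is integrable for large `n`, and `E_{θ₀}{R_{2n}} = o(1)`. -/
def A7 (M : Model d Ω 𝒴) (est : Estimator d 𝒴) (θ₀ : Par d) : Prop :=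
  ∀ k : Fin d,
    (∀ᶠ n : ℕ in atTop, Integrable (R2 M est θ₀ n k) (M.P θ₀)) ∧
    (fun n : ℕ => ∫ ω, R2 M est θ₀ n k ω ∂(M.P θ₀)) =o[atTop] (fun _ => (1 : ℝ))

/-- `θ̂_k` is integrable for large `n`, and `E_{θ₀}(θ̂_k - θ_{0k}) = B_{k,n} + R_{3n}/n` with
`R_{3n} → 0`.  The remainder may depend on `k`. -/
def A8 (M : Model d Ω 𝒴) (est : Estimator d 𝒴) (θ₀ : Par d) : Prop :=
  ∀ k : Fin d,
    (∀ᶠ n : ℕ in atTop, Integrable (fun ω => hat M est n ω k) (M.P θ₀)) ∧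
    ∃ R3 : ℕ → ℝ, Tendsto R3 atTop (𝓝 0) ∧
      ∀ᶠ n : ℕ in atTop,
        ∫ ω, (hat M est n ω k - θ₀ k) ∂(M.P θ₀) = mleBias M n θ₀ k + R3 n / n

end

end PosteriorBias

namespace PosteriorBias

/-! The definitions of `R1` and `R2` turn the posterior mean into an exact finite sum: the maximum
likelihood estimator, plus `1/n` times a deterministic Laplace term and `R2`, plus `R1 / n²`
(`postMean_eq`). Taking expectations, `A8` supplies the bias of the estimator, and `A6`–`A8` make
everything left over `o(1/n)`.

It remains to add the two deterministic contributions (`mleBias_add_laplaceLimit`). Each carries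
half of the third-derivative cumulant `κ_{rsj}`, and the halves combine into one, while the factor 2
in `mleBias` cancels its 1/2 in front of `κ_{r,js}`. The halves carry their indices in different
orders, so they match only because third partial derivatives commute (`kap3_rotate`). -/

lemma contDiffOn_pd {d : ℕ} {f : Par d → ℝ} {s : Set (Par d)} (hs : IsOpen s) {m n : WithTop ℕ∞}
    (hf : ContDiffOn ℝ n f s) (hmn : m + 1 ≤ n) (j : Fin d) : ContDiffOn ℝ m (pd j f) s :=
  (hf.fderiv_of_isOpen hs hmn).clm_apply contDiffOn_const

lemma pd_congr_of_eqOn {d : ℕ} {f g : Par d → ℝ} {s : Set (Par d)} (hs : IsOpen s)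
    (h : Set.EqOn f g s) (j : Fin d) : Set.EqOn (pd j f) (pd j g) s := by
  intro θ hθ
  simp only [pd, (h.eventuallyEq_of_mem (hs.mem_nhds hθ)).fderiv_eq]

/-- Both iterated partials are values of the second Fréchet derivative on basis vectors, and this
bilinear form is symmetric for a C² function. -/
lemma pd_comm {d : ℕ} {f : Par d → ℝ} {s : Set (Par d)} (hs : IsOpen s)
    (hf : ContDiffOn ℝ 2 f s) (i j : Fin d) : Set.EqOn (pd i (pd j f)) (pd j (pd i f)) s := by
  intro θ hθ
  have hfθ : ContDiffAt ℝ 2 f θ := hf.contDiffAt (hs.mem_nhds hθ)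
  have hd : DifferentiableAt ℝ (fderiv ℝ f) θ :=
    (hfθ.fderiv_right (m := 1) (by norm_num)).differentiableAt (by norm_num)
  have key : ∀ a b : Fin d, pd a (pd b f) θ =
      fderiv ℝ (fderiv ℝ f) θ (EuclideanSpace.single a 1) (EuclideanSpace.single b 1) := by
    intro a b
    unfold pd
    rw [fderiv_clm_apply hd (differentiableAt_const _)]
    simp
  rw [key, key]
  exact (hfθ.isSymmSndFDerivAt (by simp)) _ _

lemma pdList_three_rotate {d : ℕ} {f : Par d → ℝ} {s : Set (Par d)} (hs : IsOpen s)
    (hf : ContDiffOn ℝ 3 f s) (i j k : Fin d) :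
    Set.EqOn (pdList [i, j, k] f) (pdList [j, k, i] f) s := by
  intro θ hθ
  simp only [pdList, List.foldr]
  rw [pd_comm hs (contDiffOn_pd hs hf (by norm_num) k) i j hθ]
  -- This swap takes place under the outer derivative `pd j`, so equality at the single point `θ`
  -- would not suffice; equality on the open set does.
  exact pd_congr_of_eqOn hs (pd_comm hs (hf.of_le (by norm_num)) i k) j hθ

variable {d : ℕ} {Ω : Type*} [MeasurableSpace Ω] {𝒴 : ℕ → Type*} [∀ i, MeasurableSpace (𝒴 i)]

/-- The integrands agree for every `ω`. The ball provided by `A2` gives an open neighbourhood of `θ`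
inside `Ξ` on which the smoothness of `A1` can be used. -/
lemma kap3_rotate {M : Model d Ω 𝒴} (h1 : A1 M) (h2 : A2 M) {θ : Par d} (hθ : θ ∈ M.Ξ) (n : ℕ)
    (r s t : Fin d) : kap3 M n θ r s t = kap3 M n θ s t r := by
  obtain ⟨ε, hε, -, -, hball, -⟩ := h2 θ hθ
  unfold kap3
  congr 2
  funext ω
  exact pdList_three_rotate Metric.isOpen_ball
    (((h1.2.1 n (obs M ω)).mono hball).of_le (by norm_num)) r s t (Metric.mem_ball_self hε)

/-- The population version of the first-order term of the Laplace expansion. -/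
noncomputable def laplaceLimit (M : Model d Ω 𝒴) (n : ℕ) (θ : Par d) (k : Fin d) : ℝ :=
  ∑ j, kapInv M n θ k j *
    (pd j (fun t => Real.log (M.prior t)) θ
      + (1 / 2) * ∑ r, ∑ s, kapInv M n θ r s * kap3 M n θ r s j)

lemma mleBias_add_laplaceLimit {M : Model d Ω 𝒴} (h1 : A1 M) (h2 : A2 M) {θ : Par d}
    (hθ : θ ∈ M.Ξ) (n : ℕ) (k : Fin d) :
    mleBias M n θ k + (1 / (n : ℝ)) * laplaceLimit M n θ k =
      (1 / (n : ℝ)) * ∑ j, kapInv M n θ k j *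
        (pd j (fun t => Real.log (M.prior t)) θ
          + ∑ r, ∑ s, kapInv M n θ r s * (kap3 M n θ r s j + kap12 M n θ r j s)) := by
  have hn : (1 / (2 * (n : ℝ))) = (1 / (n : ℝ)) * (1 / 2) := by
    rw [one_div_mul_one_div, mul_comm]
  rw [mleBias, laplaceLimit, hn, mul_assoc, ← mul_add, Finset.mul_sum, ← Finset.sum_add_distrib]
  congr 1
  refine Finset.sum_congr rfl fun j _ => ?_
  simp only [mul_add, Finset.mul_sum]
  rw [add_left_comm, ← Finset.sum_add_distrib]
  congr 1
  refine Finset.sum_congr rfl fun r _ => ?_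
  rw [← Finset.sum_add_distrib]
  refine Finset.sum_congr rfl fun s _ => ?_
  -- The summation indices `s, t, u` of `mleBias` have become `j, r, s`, so its cumulant `κ_{jrs}`
  -- has to be brought to `κ_{rsj}`.
  rw [kap3_rotate h1 h2 hθ n j r s]
  ring

/-- A pointwise identity free of any analytic condition, since both remainders are defined by
solving for them; `n ≠ 0` undoes the factor `n²` in `R1`. -/
lemma postMean_eq (M : Model d Ω 𝒴) (est : Estimator d 𝒴) (θ : Par d) {n : ℕ} (hn : n ≠ 0)
    (k : Fin d) (ω : Ω) :
    postMean M n k ω = hat M est n ω k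
      + (1 / (n : ℝ)) * (R2 M est θ n k ω + laplaceLimit M n θ k)
      + (1 / (n : ℝ)) ^ 2 * R1 M est n k ω := by
  have hn' : (n : ℝ) ≠ 0 := Nat.cast_ne_zero.mpr hn
  have h : R2 M est θ n k ω + laplaceLimit M n θ k = laplaceTerm M est n k ω :=
    sub_add_cancel _ _
  rw [h, R1]
  field_simp
  ring

end PosteriorBias

theorem proposition1 {d : ℕ} {Ω : Type*} [MeasurableSpace Ω]
    {𝒴 : ℕ → Type*} [∀ i, MeasurableSpace (𝒴 i)]
    (M : PosteriorBias.Model d Ω 𝒴) (est : PosteriorBias.Estimator d 𝒴)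
    (hest : PosteriorBias.IsMLE M est)
    (h1 : PosteriorBias.A1 M) (h2 : PosteriorBias.A2 M) (h3 : PosteriorBias.A3 M)
    (h4 : PosteriorBias.A4 M) (h5 : PosteriorBias.A5 M)
    (θ₀ : PosteriorBias.Par d) (hθ₀ : θ₀ ∈ M.Ξ) (hprior : 0 < M.prior θ₀)
    (h6 : PosteriorBias.A6 M est θ₀) (h7 : PosteriorBias.A7 M est θ₀)
    (h8 : PosteriorBias.A8 M est θ₀) (k : Fin d) :
    (∀ᶠ n : ℕ in atTop, Integrable (PosteriorBias.postMean M n k) (M.P θ₀)) ∧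
    (fun n : ℕ =>
      ∫ ω, (PosteriorBias.postMean M n k ω - θ₀ k) ∂(M.P θ₀)
        - (1 / (n : ℝ)) * ∑ j, PosteriorBias.kapInv M n θ₀ k j *
            (PosteriorBias.pd j (fun t => Real.log (M.prior t)) θ₀
              + ∑ r, ∑ s, PosteriorBias.kapInv M n θ₀ r s *
                  (PosteriorBias.kap3 M n θ₀ r s j + PosteriorBias.kap12 M n θ₀ r j s)))
      =o[atTop] (fun n : ℕ => 1 / (n : ℝ)) := by
  have := M.P_isProbabilityMeasure θ₀ hθ₀
  obtain ⟨hI1, hO1⟩ := h6.2 k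
  obtain ⟨hI2, ho2⟩ := h7 k
  obtain ⟨hI3, R3, hR3, hbias⟩ := h8 k
  constructor
  · filter_upwards [hI1, hI2, hI3, eventually_ne_atTop 0] with n i1 i2 i3 hn
    rw [funext (PosteriorBias.postMean_eq M est θ₀ hn k)]
    exact (i3.add ((i2.add (integrable_const _)).const_mul _)).add (i1.const_mul _)
  have hinv : (fun n : ℕ => 1 / (n : ℝ)) =o[atTop] (fun _ => (1 : ℝ)) :=
    (isLittleO_one_iff ℝ).mpr tendsto_one_div_atTop_nhds_zero_nat
  have hrem : (fun n : ℕ => (1 / (n : ℝ)) * (R3 n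
      + ∫ ω, PosteriorBias.R2 M est θ₀ n k ω ∂(M.P θ₀)
      + (1 / (n : ℝ)) * ∫ ω, PosteriorBias.R1 M est n k ω ∂(M.P θ₀)))
      =o[atTop] (fun n : ℕ => 1 / (n : ℝ)) := by
    -- The bracket is `o(1)` term by term; the last term is `1/n = o(1)` times the bounded mean of
    -- `R1`.
    have h := (((isLittleO_one_iff ℝ).mpr hR3).add ho2).add
      (by simpa using hinv.mul_isBigO hO1)
    simpa using (isBigO_refl (fun n : ℕ => 1 / (n : ℝ)) atTop).mul_isLittleO h
  -- For all large `n` the error in the expansion is exactly this remainder, so only an identity of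
  -- expectations is left.
  refine hrem.congr' ?_ EventuallyEq.rfl
  filter_upwards [hI1, hI2, hI3, hbias, eventually_ne_atTop 0] with n i1 i2 i3 hb hn
  have hsplit : ∀ ω, PosteriorBias.postMean M n k ω - θ₀ k =
      (PosteriorBias.hat M est n ω k - θ₀ k)
      + (1 / (n : ℝ)) * (PosteriorBias.R2 M est θ₀ n k ω + PosteriorBias.laplaceLimit M n θ₀ k)
      + (1 / (n : ℝ)) ^ 2 * PosteriorBias.R1 M est n k ω := by
    intro ω
    rw [PosteriorBias.postMean_eq M est θ₀ hn k ω]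
    ring
  have i3' : Integrable (fun ω => PosteriorBias.hat M est n ω k - θ₀ k) (M.P θ₀) :=
    i3.sub (integrable_const (θ₀ k))
  have i2' : Integrable (fun ω => (1 / (n : ℝ)) * (PosteriorBias.R2 M est θ₀ n k ω
      + PosteriorBias.laplaceLimit M n θ₀ k)) (M.P θ₀) :=
    (i2.add (integrable_const _)).const_mul _
  have i32 : Integrable (fun ω => (PosteriorBias.hat M est n ω k - θ₀ k)
      + (1 / (n : ℝ)) * (PosteriorBias.R2 M est θ₀ n k ω
        + PosteriorBias.laplaceLimit M n θ₀ k)) (M.P θ₀) := i3'.add i2'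
  have hint : ∫ ω, (PosteriorBias.postMean M n k ω - θ₀ k) ∂(M.P θ₀) =
      PosteriorBias.mleBias M n θ₀ k + R3 n / n
      + (1 / (n : ℝ)) * (∫ ω, PosteriorBias.R2 M est θ₀ n k ω ∂(M.P θ₀)
        + PosteriorBias.laplaceLimit M n θ₀ k)
      + (1 / (n : ℝ)) ^ 2 * ∫ ω, PosteriorBias.R1 M est n k ω ∂(M.P θ₀) := by
    simp_rw [hsplit]
    rw [integral_add i32 (i1.const_mul _), integral_add i3' i2', hb,
      integral_const_mul, integral_const_mul, integral_add i2 (integrable_const _)]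
    simp
  rw [hint, ← PosteriorBias.mleBias_add_laplaceLimit h1 h2 hθ₀ n k]
  ring
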